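/- Let $A\in\mathbb R^{m\times n}$, let $k\in[0,n]$ be real, and let $u=(u_1,\dots,u_n)$ be a random vector with i.i.d. coordinates, $u_i=1$ with probability $k/2n$, $u_i=-1$ with probability $k/2n$, and $u_i=0$ otherwise. Let $$S(A)=\max_{Ax=0,\ x\neq 0}\frac{\|x\|_2}{\|x\|_1}$$ (with $S(A)=0$ if $A$ has trivial nullspace), and for $\xi>0$ let $$\mathcal U_\xi=\Big\{v\in\mathbb R^n:\ v^Tx+\xi\sum_{i=1}^n|v_ix_i|\le \xi\|x\|_1\ \text{ for all } x\in\mathbb R^n \text{ with } Ax=0\Big\}.$$ Let $\beta>0$, put $c=\mathbf E\|u\|_2+2\beta+4\sqrt\pi$, and suppose that $S(A)<1/c$. Then: 1. there is a (deterministic) $\xi>0$ with $\mathbf P[u\notin\mathcal U_\xi]\le 4e^{-\beta^2}$; 2. more precisely, $\mathbf P[u\notin\mathcal U_\xi]\le 4e^{-\beta^2}$ for every $\xi>0$ with $(1+\xi)\,S(A)\,c<\xi$; 3. if moreover $S(A)<1/(2c)$, then $\xi$ in (1) can be chosen in $(0,1)$. -/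

import Mathlib

open MeasureTheory ProbabilityTheory
open scoped Matrix

noncomputable section

/-- The `ℓ₁` norm of a vector of `ℝⁿ`. (On `EuclideanSpace ℝ (Fin n)`, `‖x‖` is the `ℓ₂` norm.) -/
def l1norm {n : ℕ} (x : EuclideanSpace ℝ (Fin n)) : ℝ := ∑ i, |x i|

/-- The ratios `‖x‖₂ / ‖x‖₁` of the nonzero vectors `x` with `A x = 0`. -/
def normRatioSet {m n : ℕ} (A : Matrix (Fin m) (Fin n) ℝ) : Set ℝ :=
  {r | ∃ x : EuclideanSpace ℝ (Fin n), A *ᵥ x.ofLp = 0 ∧ x ≠ 0 ∧ r = ‖x‖ / l1norm x}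

/-- `S(A)`, the maximum of `‖x‖₂ / ‖x‖₁` over the nonzero vectors `x` with `A x = 0`.
The set of ratios is bounded above by `1` (see below); if the nullspace of `A` is trivial,
the set is empty and `S(A) = 0`. -/
def normRatio {m n : ℕ} (A : Matrix (Fin m) (Fin n) ℝ) : ℝ := sSup (normRatioSet A)

/-- The set `𝒰` with parameter `ξ`: all `u` such that
`uᵀx + ξ ∑ᵢ |uᵢ xᵢ| ≤ ξ ‖x‖₁` whenever `A x = 0`. -/
def recoverableSet {m n : ℕ} (A : Matrix (Fin m) (Fin n) ℝ) (ξ : ℝ) :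
    Set (EuclideanSpace ℝ (Fin n)) :=
  {u | ∀ x : EuclideanSpace ℝ (Fin n), A *ᵥ x.ofLp = 0 →
    ∑ i, u i * x i + ξ * ∑ i, |u i * x i| ≤ ξ * l1norm x}

/-- The law on `ℝ` giving mass `k / 2n` to each of `-1` and `1`, and the rest to `0`. -/
def signalLaw (n : ℕ) (k : ℝ) : Measure ℝ :=
  ENNReal.ofReal (k / (2 * n)) • Measure.dirac (-1)
    + ENNReal.ofReal (k / (2 * n)) • Measure.dirac 1
    + ENNReal.ofReal (1 - k / n) • Measure.dirac 0

/-- `u` is a random vector whose coordinates are i.i.d. with law `signalLaw n k`. -/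
structure IsRandomSignal {n : ℕ} {Ω : Type*} [MeasurableSpace Ω] (k : ℝ)
    (u : Ω → EuclideanSpace ℝ (Fin n)) (μ : Measure Ω) : Prop where
  measurable : ∀ i, Measurable fun ω => u ω i
  indep : iIndepFun (fun i ω => u ω i) μ
  law : ∀ i, μ.map (fun ω => u ω i) = signalLaw n k

theorem normRatioSet_le_one {m n : ℕ} (A : Matrix (Fin m) (Fin n) ℝ) :
    ∀ r ∈ normRatioSet A, r ≤ 1 := by
  rintro r ⟨x, -, -, rfl⟩
  have h0 : 0 ≤ l1norm x := Finset.sum_nonneg fun i _ => abs_nonneg _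
  refine div_le_one_of_le₀ ?_ h0
  rw [EuclideanSpace.norm_eq]
  refine Real.sqrt_le_iff.2 ⟨h0, ?_⟩
  exact Finset.sum_sq_le_sq_sum_of_nonneg fun i _ => norm_nonneg _

theorem normRatioSet_bddAbove {m n : ℕ} (A : Matrix (Fin m) (Fin n) ℝ) :
    BddAbove (normRatioSet A) :=
  ⟨1, normRatioSet_le_one A⟩

end

/-! By Cauchy–Schwarz, on the nullspace `uᵀx + ξ ∑ |uᵢxᵢ|` is at most `(1 + ξ) ‖u‖₂ S(A) ‖x‖₁`, so
recovery can fail only if `‖u‖₂ > c` (`mem_recoverableSet_of_norm_le`). The rest is concentration: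
`‖u‖₂²` is binomial with mean `k`, and a Chernoff bound (`measure_norm_ge_le`) gives `‖u‖₂` a
Gaussian upper tail above `√(max k 1)`, which exceeds `E‖u‖₂` by at most `1`
(`sqrt_max_le_integral_norm_add_one`). -/

open Finset in
theorem norm_le_normRatio_mul {m n : ℕ} (A : Matrix (Fin m) (Fin n) ℝ)
    (x : EuclideanSpace ℝ (Fin n)) (hx : A *ᵥ x.ofLp = 0) :
    ‖x‖ ≤ normRatio A * l1norm x := by
  by_cases h : x = 0
  · subst h; simp [l1norm]
  · have hpos : 0 < l1norm x := by
      obtain ⟨i, hi⟩ : ∃ i, x i ≠ 0 := by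
        by_contra! hc
        exact h (by ext i; simpa using hc i)
      exact sum_pos' (fun i _ => abs_nonneg _) ⟨i, mem_univ i, abs_pos.2 hi⟩
    rw [← div_le_iff₀ hpos]
    exact le_csSup (normRatioSet_bddAbove A) ⟨x, hx, h, rfl⟩

theorem normRatio_nonneg {m n : ℕ} (A : Matrix (Fin m) (Fin n) ℝ) : 0 ≤ normRatio A := by
  refine Real.sSup_nonneg ?_
  rintro r ⟨x, -, -, rfl⟩
  exact div_nonneg (norm_nonneg _) (Finset.sum_nonneg fun i _ => abs_nonneg _)

theorem sum_abs_mul_le_norm_mul_norm {n : ℕ} (u x : EuclideanSpace ℝ (Fin n)) :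
    ∑ i, |u i * x i| ≤ ‖u‖ * ‖x‖ := by
  have h := Real.sum_mul_le_sqrt_mul_sqrt Finset.univ (fun i => |u i|) (fun i => |x i|)
  simpa [EuclideanSpace.norm_eq, abs_mul] using h

/-- Signals of small `ℓ₂` norm are recoverable. -/
theorem mem_recoverableSet_of_norm_le {m n : ℕ} (A : Matrix (Fin m) (Fin n) ℝ) {ξ c : ℝ}
    (hξ : 0 < ξ) (hc : (1 + ξ) * normRatio A * c ≤ ξ) {u : EuclideanSpace ℝ (Fin n)}
    (hu : ‖u‖ ≤ c) : u ∈ recoverableSet A ξ := by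
  intro x hx
  have h1 : ∑ i, u i * x i ≤ ∑ i, |u i * x i| :=
    Finset.sum_le_sum fun i _ => le_abs_self _
  have hl : 0 ≤ l1norm x := Finset.sum_nonneg fun i _ => abs_nonneg _
  calc ∑ i, u i * x i + ξ * ∑ i, |u i * x i|
      ≤ (1 + ξ) * ∑ i, |u i * x i| := by linarith
    _ ≤ (1 + ξ) * (c * (normRatio A * l1norm x)) := by
        gcongr
        exact (sum_abs_mul_le_norm_mul_norm u x).trans
          (mul_le_mul hu (norm_le_normRatio_mul A x hx) (norm_nonneg _)
            ((norm_nonneg _).trans hu))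
    _ = ((1 + ξ) * normRatio A * c) * l1norm x := by ring
    _ ≤ ξ * l1norm x := by gcongr

/-! ### Moments of the random signal -/

theorem integrable_signalLaw (n : ℕ) (k : ℝ) (f : ℝ → ℝ) : Integrable f (signalLaw n k) := by
  have h (a : ℝ) : Integrable f (Measure.dirac a) := integrable_dirac (by simp)
  exact (((h _).smul_measure (by simp)).add_measure ((h _).smul_measure (by simp))).add_measure
    ((h _).smul_measure (by simp))

theorem integral_signalLaw {n : ℕ} {k : ℝ} (hk0 : 0 ≤ k) (hkn : k ≤ n) (f : ℝ → ℝ) :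
    ∫ x, f x ∂signalLaw n k
      = k / (2 * n) * f (-1) + k / (2 * n) * f 1 + (1 - k / n) * f 0 := by
  have h (a : ℝ) : Integrable f (Measure.dirac a) := integrable_dirac (by simp)
  have hs (a : ℝ) {c : ENNReal} (hc : c ≠ ⊤) : Integrable f (c • Measure.dirac a) :=
    (h a).smul_measure hc
  have h1 : k / n ≤ 1 := div_le_one_of_le₀ hkn (Nat.cast_nonneg n)
  rw [signalLaw, integral_add_measure ((hs _ (by simp)).add_measure (hs _ (by simp)))
    (hs _ (by simp)), integral_add_measure (hs _ (by simp)) (hs _ (by simp))]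
  simp only [integral_smul_measure, integral_dirac, smul_eq_mul]
  rw [ENNReal.toReal_ofReal (by positivity), ENNReal.toReal_ofReal (by linarith)]

namespace IsRandomSignal

variable {n : ℕ} {Ω : Type*} [MeasurableSpace Ω] {k : ℝ} {u : Ω → EuclideanSpace ℝ (Fin n)}
  {μ : Measure Ω}

theorem integrable_comp (hu : IsRandomSignal k u μ) {f : ℝ → ℝ} (hf : Measurable f) (i : Fin n) :
    Integrable (fun ω => f (u ω i)) μ := by
  have h := integrable_signalLaw n k f
  rw [← hu.law i] at h
  exact (integrable_map_measure hf.aestronglyMeasurable (hu.measurable i).aemeasurable).1 h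

theorem integral_comp (hu : IsRandomSignal k u μ) (hk0 : 0 ≤ k) (hkn : k ≤ n) {f : ℝ → ℝ}
    (hf : Measurable f) (i : Fin n) :
    ∫ ω, f (u ω i) ∂μ = k / (2 * n) * f (-1) + k / (2 * n) * f 1 + (1 - k / n) * f 0 := by
  rw [← integral_signalLaw hk0 hkn, ← hu.law i,
    integral_map (hu.measurable i).aemeasurable hf.aestronglyMeasurable]

theorem indep_sq (hu : IsRandomSignal k u μ) : iIndepFun (fun i ω => u ω i ^ 2) μ :=
  hu.indep.comp (fun _ x => x ^ 2) fun _ => by fun_prop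

theorem memLp_sq (hu : IsRandomSignal k u μ) (i : Fin n) : MemLp (fun ω => u ω i ^ 2) 2 μ := by
  rw [memLp_two_iff_integrable_sq ((hu.measurable i).pow_const 2).aestronglyMeasurable]
  exact hu.integrable_comp (f := fun x => (x ^ 2) ^ 2) (by fun_prop) i

theorem integral_sq_norm (hu : IsRandomSignal k u μ) (hk0 : 0 ≤ k) (hkn : k ≤ n) :
    ∫ ω, ‖u ω‖ ^ 2 ∂μ = k := by
  simp only [EuclideanSpace.real_norm_sq_eq]
  rw [integral_finsetSum _ fun i _ => hu.integrable_comp (f := fun x => x ^ 2) (by fun_prop) i]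
  simp only [hu.integral_comp (f := fun x => x ^ 2) hk0 hkn (by fun_prop)]
  rcases Nat.eq_zero_or_pos n with rfl | hn
  · simp at hkn ⊢; linarith
  · have : (n : ℝ) ≠ 0 := by positivity
    simp; field_simp; norm_num

/-- Variances add by independence, and `uᵢ⁴ = uᵢ²` almost surely, so each coordinate contributes at
most `k / n`. -/
theorem variance_sq_norm_le [IsProbabilityMeasure μ] (hu : IsRandomSignal k u μ) (hk0 : 0 ≤ k)
    (hkn : k ≤ n) : variance (fun ω => ‖u ω‖ ^ 2) μ ≤ k := by
  have hfun : (fun ω => ‖u ω‖ ^ 2) = ∑ i, fun ω => u ω i ^ 2 := by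
    ext ω; simp [EuclideanSpace.real_norm_sq_eq]
  rw [hfun, IndepFun.variance_sum (fun i _ => hu.memLp_sq i)
    (fun i _ j _ hij => hu.indep_sq.indepFun hij)]
  have hi (i : Fin n) : variance (fun ω => u ω i ^ 2) μ ≤ k / n := by
    refine (variance_le_expectation_sq (hu.memLp_sq i).aestronglyMeasurable).trans_eq ?_
    have := hu.integral_comp (f := fun x => (x ^ 2) ^ 2) hk0 hkn (by fun_prop) i
    simp only [Pi.pow_apply, this]
    ring
  calc _ ≤ ∑ _i : Fin n, k / n := Finset.sum_le_sum fun i _ => hi i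
    _ ≤ k := by
      rcases Nat.eq_zero_or_pos n with rfl | hn
      · simpa using hk0
      · have : (n : ℝ) ≠ 0 := by positivity
        simp; field_simp; exact le_rfl

theorem memLp_sq_norm (hu : IsRandomSignal k u μ) : MemLp (fun ω => ‖u ω‖ ^ 2) 2 μ := by
  simp only [EuclideanSpace.real_norm_sq_eq]
  exact memLp_finsetSum _ fun i _ => hu.memLp_sq i

theorem measurable_norm (hu : IsRandomSignal k u μ) : Measurable fun ω => ‖u ω‖ := by
  simp only [EuclideanSpace.norm_eq, Real.norm_eq_abs, sq_abs]
  exact (Finset.measurable_fun_sum _ fun i _ => (hu.measurable i).pow_const 2).sqrt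

theorem integrable_norm [IsProbabilityMeasure μ] (hu : IsRandomSignal k u μ) :
    Integrable (fun ω => ‖u ω‖) μ := by
  have h2 : MemLp (fun ω => ‖u ω‖) 2 μ :=
    (memLp_two_iff_integrable_sq hu.measurable_norm.aestronglyMeasurable).2
      (hu.memLp_sq_norm.integrable (by norm_num))
  exact h2.integrable (by norm_num)

/-- The mean of `‖u‖₂` is within `1` of the square root of the mean of `‖u‖₂²`. -/
theorem sqrt_max_le_integral_norm_add_one [IsProbabilityMeasure μ] (hu : IsRandomSignal k u μ)
    (hk0 : 0 ≤ k) (hkn : k ≤ n) : √(max k 1) ≤ (∫ ω, ‖u ω‖ ∂μ) + 1 := by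
  have h0 : 0 ≤ ∫ ω, ‖u ω‖ ∂μ := integral_nonneg fun ω => norm_nonneg _
  rcases le_total k 1 with hk | hk
  · rw [max_eq_right hk, Real.sqrt_one]; linarith
  rw [max_eq_left hk]
  obtain ⟨s, hs, rfl⟩ : ∃ s, 1 ≤ s ∧ k = s ^ 2 :=
    ⟨√k, Real.one_le_sqrt.2 hk, (Real.sq_sqrt hk0).symm⟩
  rw [Real.sqrt_sq (by linarith)]
  -- pointwise bound, cleared of denominators
  have hpt (y : ℝ) (hy : 0 ≤ y) :
      2 * s ^ 4 + s ^ 2 * (y ^ 2 - s ^ 2) - (y ^ 2 - s ^ 2) ^ 2 ≤ 2 * s ^ 3 * y := by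
    -- This product is exactly right side minus left side. Taking expectations at `y = ‖u‖₂` will
    -- give `E‖u‖₂ ≥ s - 1/(2s)`.
    have : 0 ≤ y * (y - s) ^ 2 * (y + 2 * s) := by positivity
    nlinarith [this]
  have hInt2 := hu.memLp_sq_norm.integrable (by norm_num)
  have hv : ∫ ω, (‖u ω‖ ^ 2 - s ^ 2) ^ 2 ∂μ ≤ s ^ 2 := by
    have h := hu.variance_sq_norm_le hk0 hkn
    rwa [variance_eq_integral hu.memLp_sq_norm.aemeasurable, hu.integral_sq_norm hk0 hkn] at h
  have hvI : Integrable (fun ω => (‖u ω‖ ^ 2 - s ^ 2) ^ 2) μ :=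
    (hu.memLp_sq_norm.sub (memLp_const (s ^ 2))).integrable_sq
  have hI1 : Integrable (fun ω => s ^ 2 * (‖u ω‖ ^ 2 - s ^ 2)) μ :=
    (hInt2.sub (integrable_const _)).const_mul _
  have hI2 : Integrable (fun ω => 2 * s ^ 4 + s ^ 2 * (‖u ω‖ ^ 2 - s ^ 2)) μ :=
    (integrable_const _).add hI1
  have hmono := integral_mono (hI2.sub hvI) (hu.integrable_norm.const_mul (2 * s ^ 3))
    fun ω => hpt _ (norm_nonneg (u ω))
  rw [integral_sub' hI2 hvI, integral_add (integrable_const _) hI1, integral_const_mul (s ^ 2),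
    integral_sub hInt2 (integrable_const _), hu.integral_sq_norm hk0 hkn,
    integral_const_mul (2 * s ^ 3)]
    at hmono
  simp only [integral_const, probReal_univ, one_smul, sub_self, mul_zero, add_zero] at hmono
  have h3 : s ^ 2 * (2 * s ^ 2 - 1) ≤ s ^ 2 * (2 * s * ∫ ω, ‖u ω‖ ∂μ) := by
    linarith
  have h4 := le_of_mul_le_mul_left h3 (by positivity)
  nlinarith

/-- Each factor is `1 + (k/n)(eᵗ - 1) ≤ exp((k/n)(eᵗ - 1))`; the product is the Poisson bound of
mean `k`. -/
theorem mgf_sq_norm_le [IsProbabilityMeasure μ] (hu : IsRandomSignal k u μ) (hk0 : 0 ≤ k)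
    (hkn : k ≤ n) {t : ℝ} :
    Integrable (fun ω => Real.exp (t * ‖u ω‖ ^ 2)) μ ∧
      mgf (fun ω => ‖u ω‖ ^ 2) μ t ≤ Real.exp (k * (Real.exp t - 1)) := by
  have hfun : (fun ω => ‖u ω‖ ^ 2) = ∑ i, fun ω => u ω i ^ 2 := by
    ext ω; simp [EuclideanSpace.real_norm_sq_eq]
  have hmeas (i : Fin n) : Measurable fun ω => u ω i ^ 2 := (hu.measurable i).pow_const 2
  have hm (i : Fin n) : mgf (fun ω => u ω i ^ 2) μ t ≤ Real.exp (k / n * (Real.exp t - 1)) := by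
    have := hu.integral_comp (f := fun x => Real.exp (t * x ^ 2)) hk0 hkn (by fun_prop) i
    simp only [mgf, this]
    refine le_trans (le_of_eq ?_) (Real.add_one_le_exp _)
    simp
    ring
  constructor
  · have := hu.indep_sq.integrable_exp_mul_sum (t := t) hmeas (s := Finset.univ) fun i _ =>
      hu.integrable_comp (f := fun x => Real.exp (t * x ^ 2)) (by fun_prop) i
    rwa [← hfun] at this
  · rw [hfun, hu.indep_sq.mgf_sum hmeas]
    calc _ ≤ ∏ _i : Fin n, Real.exp (k / n * (Real.exp t - 1)) :=
          Finset.prod_le_prod (fun i _ => mgf_nonneg) fun i _ => hm i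
      _ ≤ _ := by
        rw [Finset.prod_const, ← Real.exp_nat_mul]
        rcases Nat.eq_zero_or_pos n with rfl | hn
        · have : k = 0 := le_antisymm (by simpa using hkn) hk0
          simp [this]
        · have : (n : ℝ) ≠ 0 := by positivity
          simp only [Finset.card_univ, Fintype.card_fin]
          rw [← mul_assoc, mul_div_cancel₀ _ this]

/-- Upper tail of `‖u‖₂`, by the Chernoff bound for the binomial variable `‖u‖₂²`. -/
theorem measure_norm_ge_le [IsProbabilityMeasure μ] (hu : IsRandomSignal k u μ) (hk0 : 0 ≤ k)
    (hkn : k ≤ n) {K b : ℝ} (hK : 0 < K) (hkK : k ≤ K ^ 2) (hb : 0 ≤ b) :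
    μ.real {ω | K + b ≤ ‖u ω‖} ≤ Real.exp (-b ^ 2) := by
  set r : ℝ := (K + b) / K with hr
  have hr1 : 1 ≤ r := (one_le_div hK).2 (by linarith)
  have hr0 : 0 < r := by linarith
  -- The minimiser of `K²(eᵗ - 1) - t(K + b)²`.
  set t : ℝ := 2 * Real.log r with ht
  have ht0 : 0 ≤ t := mul_nonneg zero_le_two (Real.log_nonneg hr1)
  have hexp : Real.exp t = r ^ 2 := by
    rw [ht, two_mul, Real.exp_add, Real.exp_log hr0, sq]
  have hlog : 2 * (1 - r⁻¹) ≤ t := by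
    have := Real.one_sub_inv_le_log_of_pos hr0
    linarith
  obtain ⟨hint, hmgf⟩ := hu.mgf_sq_norm_le hk0 hkn (t := t)
  have hsub : {ω | K + b ≤ ‖u ω‖} ⊆ {ω | (K + b) ^ 2 ≤ ‖u ω‖ ^ 2} :=
    fun ω (hω : K + b ≤ ‖u ω‖) => pow_le_pow_left₀ (by positivity : 0 ≤ K + b) hω 2
  refine (measureReal_mono hsub).trans ((measure_ge_le_exp_mul_mgf _ ht0 hint).trans ?_)
  refine (mul_le_mul_of_nonneg_left hmgf (Real.exp_nonneg _)).trans ?_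
  rw [← Real.exp_add, Real.exp_le_exp, hexp]
  have h1 : k * (r ^ 2 - 1) ≤ K ^ 2 * (r ^ 2 - 1) :=
    mul_le_mul_of_nonneg_right hkK (by nlinarith)
  have h2 : K ^ 2 * (r ^ 2 - 1) = (K + b) ^ 2 - K ^ 2 := by
    rw [hr]; field_simp
  have h3 : (K + b) ^ 2 * (2 * (1 - r⁻¹)) ≤ (K + b) ^ 2 * t :=
    mul_le_mul_of_nonneg_left hlog (sq_nonneg _)
  have h4 : (K + b) ^ 2 * (2 * (1 - r⁻¹)) = 2 * (K + b) * b := by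
    have : K + b ≠ 0 := by positivity
    rw [hr]; field_simp; ring
  nlinarith

end IsRandomSignal

theorem mainTheorem8 {m n : ℕ} (A : Matrix (Fin m) (Fin n) ℝ)
    (k : ℝ) (hk0 : 0 ≤ k) (hkn : k ≤ n)
    {Ω : Type*} [MeasurableSpace Ω] (μ : Measure Ω) [IsProbabilityMeasure μ]
    (u : Ω → EuclideanSpace ℝ (Fin n)) (hu : IsRandomSignal k u μ)
    (β : ℝ) (hβ : 0 < β)
    (hS : normRatio A < 1 / ((∫ ω, ‖u ω‖ ∂μ) + 2 * β + 4 * √Real.pi)) :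
    (∃ ξ : ℝ, 0 < ξ ∧
      μ.real {ω | u ω ∉ recoverableSet A ξ} ≤ 4 * Real.exp (-β ^ 2)) ∧
    (∀ ξ : ℝ, 0 < ξ →
      (1 + ξ) * normRatio A * ((∫ ω, ‖u ω‖ ∂μ) + 2 * β + 4 * √Real.pi) < ξ →
      μ.real {ω | u ω ∉ recoverableSet A ξ} ≤ 4 * Real.exp (-β ^ 2)) ∧
    (normRatio A < 1 / (2 * ((∫ ω, ‖u ω‖ ∂μ) + 2 * β + 4 * √Real.pi)) →
      ∃ ξ : ℝ, 0 < ξ ∧ ξ < 1 ∧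
        μ.real {ω | u ω ∉ recoverableSet A ξ} ≤ 4 * Real.exp (-β ^ 2)) := by
  have hI0 : 0 ≤ ∫ ω, ‖u ω‖ ∂μ := integral_nonneg fun ω => norm_nonneg _
  set c : ℝ := (∫ ω, ‖u ω‖ ∂μ) + 2 * β + 4 * √Real.pi with hc
  have hc0 : 0 < c := by positivity
  have htail : μ.real {ω | c ≤ ‖u ω‖} ≤ 4 * Real.exp (-β ^ 2) := by
    have hpi : 1 ≤ √Real.pi := Real.one_le_sqrt.2 (by linarith [Real.pi_gt_three])
    have hsqrt := hu.sqrt_max_le_integral_norm_add_one hk0 hkn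
    have hK : 0 < √(max k 1) := Real.sqrt_pos.2 (lt_max_of_lt_right one_pos)
    have hkK : k ≤ √(max k 1) ^ 2 := by
      rw [Real.sq_sqrt (le_max_of_le_left hk0)]; exact le_max_left _ _
    -- Only `E‖u‖₂ + 1 + β ≤ c` is needed.
    have hsub : {ω | c ≤ ‖u ω‖} ⊆ {ω | √(max k 1) + β ≤ ‖u ω‖} := fun ω (hω : c ≤ ‖u ω‖) =>
      le_trans (by linarith) hω
    refine (measureReal_mono hsub).trans ((hu.measure_norm_ge_le hk0 hkn hK hkK hβ.le).trans ?_)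
    linarith [Real.exp_pos (-β ^ 2)]
  have hmain : ∀ ξ : ℝ, 0 < ξ → (1 + ξ) * normRatio A * c < ξ →
      μ.real {ω | u ω ∉ recoverableSet A ξ} ≤ 4 * Real.exp (-β ^ 2) := by
    intro ξ hξ h
    refine (measureReal_mono fun ω hω => ?_).trans htail
    by_contra hlt
    exact hω (mem_recoverableSet_of_norm_le A hξ h.le (not_le.1 hlt).le)
  have hS0 : 0 ≤ normRatio A * c := mul_nonneg (normRatio_nonneg A) hc0.le
  refine ⟨?_, hmain, fun hS2 => ?_⟩
  · have hS1 : normRatio A * c < 1 := (lt_div_iff₀ hc0).1 hS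
    have hd : 0 < 1 - normRatio A * c := by linarith
    -- With `a = S(A)c`, the condition on `ξ` reads `a < ξ(1 - a)`; here the right side is `1`.
    refine ⟨1 / (1 - normRatio A * c), by positivity, hmain _ (by positivity) ?_⟩
    have : 1 / (1 - normRatio A * c) * (1 - normRatio A * c) = 1 := by field_simp
    nlinarith
  · have hS1 : normRatio A * (2 * c) < 1 := (lt_div_iff₀ (by positivity)).1 hS2
    -- For this `ξ` the condition becomes `(a + 1)(a - 1/2) < 0`, with `a = S(A)c < 1/2`.
    refine ⟨normRatio A * c + 1 / 2, by linarith, by linarith, hmain _ (by linarith) ?_⟩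
    nlinarith
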